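/- **Setting.** A *DB schema* is a pair $\langle\Sigma,T\rangle$, where $\Sigma$ is a finite many-sorted signature whose only symbols are equality, unary functions and constants, and $T$ is a set of universal $\Sigma$-sentences. Carriers of structures are non-empty. $\Sigma$ is *acyclic* if the directed graph whose nodes are the sorts and whose edges are the function symbols $f:S\to S'$ (from $S$ to $S'$) has no directed cycle. A *model completion* of $T$ is a set $T^*\supseteq T$ of $\Sigma$-sentences that has quantifier elimination and such that every conjunction of literals satisfiable in a model of $T$ is satisfiable in a model of $T^*$. An *artifact setting* adds to $\Sigma$ finitely many new *artifact sorts*, finitely many individual variables $\underline x$ (*artifact variables*) of sorts of $\Sigma$, and finitely many unary function variables $\underline a$ (*artifact components*), each with an artifact sort as source and a sort of $\Sigma$ as target. The artifact sorts, with the sorts and symbols of $\Sigma$, form the extended signature $\Sigma_{\mathrm{ext}}$. A $\Sigma_{\mathrm{ext}}$-structure is a model of $T$ (of $T^*$) if its reduct to $\Sigma$ is; satisfiability of a formula $\phi(\underline x,\underline a)$ means that it is true under some assignment to $\underline x,\underline a$ in some such model. - An *initial formula* $\iota$ has the form $\bigwedge_i x_i=c_i\wedge\bigwedge_j a_j=\lambda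 y.d_j$ with $c_i,d_j$ constants of $\Sigma$. - A *state formula* is a finite disjunction of formulae $\exists\underline e\,\phi(\underline e,\underline x,\underline a)$ with $\phi$ quantifier-free and $\underline e$ variables of artifact sorts. - A *transition formula* has the form $$\exists\underline e\,\Big(\gamma(\underline e,\underline x,\underline a)\wedge\bigwedge_i x_i'=F_i(\underline e,\underline x,\underline a)\wedge\bigwedge_j a_j'=\lambda y.\,G_j(y,\underline e,\underline x,\underline a)\Big),$$ where the $\underline e$ have arbitrary sorts, $\gamma$ is quantifier-free, and $F_i,G_j$ are case-defined functions, i.e. given by finitely many terms $t_l$ under quantifier-free conditions $\kappa_l$ that are exhaustive and pairwise exclusive modulo $T$. A *RAS* consists of a DB schema, an artifact setting, an initial formula $\iota$ and a finite disjunction $\tau$ of transition formulae. For a state formula $\phi$, $\mathit{Pre}(\tau,\phi)$ is $\exists\underline x'\exists\underline a'\,(\tau(\underline x,\underline a,\underline x',\underline a')\wedge\phi(\underline x',\underline a'))$. A state formula is *local* if it is a finite disjunction of formulae $$\exists e_1\cdots\exists e_k\Big(\delta(e_1,\dots,e_k)\wedge\bigwedge_{i=1}^k\phi_i(e_i,\underline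 x,\underline a)\Big),$$ where $\delta$ is a conjunction of equalities and inequalities between the variables $e_1,\dots,e_k$ of artifact sorts and each $\phi_i$ is quantifier-free with $e_i$ as its only variable among the $e$'s (further quantifier-free conjuncts $\psi(\underline x)$ are allowed too). Given $T^*$, a transition formula $\hat\tau$ is *local* if for every local $\phi$ there is a local formula equivalent to $\mathit{Pre}(\hat\tau,\phi)$ in all $\Sigma_{\mathrm{ext}}$-models of $T^*$. *Backward search* on a state formula $\upsilon$ (the safety formula) is the procedure: set $\phi:=\upsilon$ and $B:=\bot$; while $\phi\wedge\neg B$ is satisfiable in a model of $T$: if $\iota\wedge\phi$ is satisfiable in a model of $T$, return "unsafe"; otherwise set $B:=\phi\vee B$ and replace $\phi$ by a state formula equivalent to $\mathit{Pre}(\tau,\phi)$ in all $\Sigma_{\mathrm{ext}}$-models of $T^*$ (quantifier elimination); when the loop ends, return "safe". **Theorem.** Consider a RAS whose signature $\Sigma$ is acyclic, let $T^*$ be a model completion of its theory $T$, and assume that $\tau$ is a disjunction of transition formulae that are local. Then backward search, applied to any local safety formula $\upsilon$, terminates: whichever state formulae the quantifier elimination steps return, each such step can be carried out, and the procedure returns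 "safe" or "unsafe" after finitely many rounds. -/

import Mathlib

/-! Many-sorted first-order logic over signatures with unary functions, constants and equality,
DB schemas, relational artifact systems and backward search. -/

namespace ArtSys

/-- A finite multi-sorted signature whose only symbols are equality, unary functions and constants:
`Func s s'` is the set of function symbols with source `s` and target `s'`, and `Const s` is the
set of constants of sort `s`. -/
structure Signature where
  Srt : Type
  Func : Srt → Srt → Type
  Const : Srt → Type
  finite_srt : Finite Srt
  finite_func : ∀ s s', Finite (Func s s')
  finite_const : ∀ s, Finite (Const s)

/-- Edges of the characteristic graph (without labels): there is a function symbol `s → s'`. -/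
def Signature.Edge (S : Signature) (s s' : S.Srt) : Prop := Nonempty (S.Func s s')

/-- The characteristic graph has no directed cycle (in particular no loop). -/
def Signature.Acyclic (S : Signature) : Prop :=
  ∀ s, ¬ Relation.TransGen S.Edge s s

/-- Contexts list the sorts of the available variables. -/
abbrev Ctx (S : Signature) (n : ℕ) : Type := Fin n → S.Srt

/-- The context `Γ` with one more variable of sort `s` in front, which gets index `0`. -/
def Ctx.cons {S : Signature} {n : ℕ} (s : S.Srt) (Γ : Ctx S n) : Ctx S (n + 1) :=
  Fin.cons (α := fun _ => S.Srt) s Γ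

/-- Well-sorted terms with variables in `Γ`. -/
inductive Term (S : Signature) {n : ℕ} (Γ : Ctx S n) : S.Srt → Type
  | var (i : Fin n) : Term S Γ (Γ i)
  | const {s : S.Srt} (c : S.Const s) : Term S Γ s
  | app {s s' : S.Srt} (f : S.Func s s') (t : Term S Γ s) : Term S Γ s'

/-- Quantifier-free formulae with variables in `Γ`. -/
inductive QF (S : Signature) {n : ℕ} (Γ : Ctx S n) : Type
  | tru : QF S Γ
  | eq {s : S.Srt} (t u : Term S Γ s) : QF S Γ
  | not (φ : QF S Γ) : QF S Γ
  | and (φ ψ : QF S Γ) : QF S Γ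
  | or (φ ψ : QF S Γ) : QF S Γ

/-- First-order formulae with free variables in `Γ`. -/
inductive Formula (S : Signature) : {n : ℕ} → Ctx S n → Type
  | qf {n : ℕ} {Γ : Ctx S n} (φ : QF S Γ) : Formula S Γ
  | not {n : ℕ} {Γ : Ctx S n} (φ : Formula S Γ) : Formula S Γ
  | and {n : ℕ} {Γ : Ctx S n} (φ ψ : Formula S Γ) : Formula S Γ
  | or {n : ℕ} {Γ : Ctx S n} (φ ψ : Formula S Γ) : Formula S Γ
  | all {n : ℕ} {Γ : Ctx S n} (s : S.Srt) (φ : Formula S (Γ.cons s)) : Formula S Γ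
  | ex {n : ℕ} {Γ : Ctx S n} (s : S.Srt) (φ : Formula S (Γ.cons s)) : Formula S Γ

/-- Sentences are formulae without free variables. -/
abbrev Sentence (S : Signature) : Type := Formula S (Fin.elim0 : Ctx S 0)

/-- Universal formulae: a block of universal quantifiers before a quantifier-free formula. -/
inductive Formula.IsUniversal {S : Signature} : {n : ℕ} → {Γ : Ctx S n} → Formula S Γ → Prop
  | qf {n : ℕ} {Γ : Ctx S n} (φ : QF S Γ) : IsUniversal (Formula.qf φ)
  | all {n : ℕ} {Γ : Ctx S n} (s : S.Srt) (φ : Formula S (Γ.cons s)) :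
      IsUniversal φ → IsUniversal (Formula.all s φ)

/-- Conjunctions of literals (equations and negated equations), the empty one included. -/
inductive QF.IsConstraint {S : Signature} {n : ℕ} {Γ : Ctx S n} : QF S Γ → Prop
  | tru : IsConstraint QF.tru
  | eq {s : S.Srt} (t u : Term S Γ s) : IsConstraint (QF.eq t u)
  | neq {s : S.Srt} (t u : Term S Γ s) : IsConstraint (QF.not (QF.eq t u))
  | and (φ ψ : QF S Γ) : IsConstraint φ → IsConstraint ψ → IsConstraint (QF.and φ ψ)

/-- Structures for a signature. As usual in first-order logic, carriers are non-empty. -/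
structure Struc (S : Signature) where
  carrier : S.Srt → Type
  nonempty : ∀ s, Nonempty (carrier s)
  func : ∀ {s s' : S.Srt}, S.Func s s' → carrier s → carrier s'
  const : ∀ {s : S.Srt}, S.Const s → carrier s

/-- Assignments of elements of `M` to the variables of `Γ`. -/
abbrev Struc.Env {S : Signature} (M : Struc S) {n : ℕ} (Γ : Ctx S n) : Type :=
  ∀ i : Fin n, M.carrier (Γ i)

/-- Extend an assignment by a value for the new variable `0`. -/
def Struc.consEnv {S : Signature} (M : Struc S) {n : ℕ} {Γ : Ctx S n} {s : S.Srt}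
    (a : M.carrier s) (ε : M.Env Γ) : M.Env (Γ.cons s) :=
  Fin.cases (motive := fun i => M.carrier (Γ.cons s i)) a ε

/-- Value of a term. -/
def Term.val {S : Signature} (M : Struc S) {n : ℕ} {Γ : Ctx S n} (ε : M.Env Γ) :
    {s : S.Srt} → Term S Γ s → M.carrier s
  | _, .var i => ε i
  | _, .const c => M.const c
  | _, .app f t => M.func f (t.val M ε)

/-- Truth of a quantifier-free formula. -/
def QF.Holds {S : Signature} (M : Struc S) {n : ℕ} {Γ : Ctx S n} (ε : M.Env Γ) : QF S Γ → Prop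
  | .tru => True
  | .eq t u => t.val M ε = u.val M ε
  | .not φ => ¬ φ.Holds M ε
  | .and φ ψ => φ.Holds M ε ∧ ψ.Holds M ε
  | .or φ ψ => φ.Holds M ε ∨ ψ.Holds M ε

/-- Truth of a first-order formula. -/
def Formula.Holds {S : Signature} (M : Struc S) :
    {n : ℕ} → {Γ : Ctx S n} → Formula S Γ → M.Env Γ → Prop
  | _, _, .qf φ, ε => φ.Holds M ε
  | _, _, .not φ, ε => ¬ φ.Holds M ε
  | _, _, .and φ ψ, ε => φ.Holds M ε ∧ ψ.Holds M ε
  | _, _, .or φ ψ, ε => φ.Holds M ε ∨ ψ.Holds M ε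
  | _, _, .all s φ, ε => ∀ a : M.carrier s, φ.Holds M (M.consEnv a ε)
  | _, _, .ex s φ, ε => ∃ a : M.carrier s, φ.Holds M (M.consEnv a ε)

/-- `M` is a model of the theory `T`. -/
def Struc.Models {S : Signature} (M : Struc S) (T : Set (Sentence S)) : Prop :=
  ∀ φ ∈ T, ∀ ε : M.Env (Fin.elim0 : Ctx S 0), φ.Holds M ε

/-- `T` has quantifier elimination. -/
def HasQE {S : Signature} (T : Set (Sentence S)) : Prop :=
  ∀ (n : ℕ) (Γ : Ctx S n) (φ : Formula S Γ), ∃ ψ : QF S Γ,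
    ∀ M : Struc S, M.Models T → ∀ ε : M.Env Γ, φ.Holds M ε ↔ ψ.Holds M ε

/-- `T'` is a model completion of `T`: it extends `T`, every constraint satisfiable in a model of
`T` is satisfiable in a model of `T'`, and `T'` has quantifier elimination. -/
structure IsModelCompletion {S : Signature} (T T' : Set (Sentence S)) : Prop where
  subset : T ⊆ T'
  sat : ∀ (n : ℕ) (Γ : Ctx S n) (φ : QF S Γ), φ.IsConstraint →
    (∃ M : Struc S, M.Models T ∧ ∃ ε : M.Env Γ, φ.Holds M ε) →
    ∃ M : Struc S, M.Models T' ∧ ∃ ε : M.Env Γ, φ.Holds M ε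
  qe : HasQE T'

/-- An artifact extension of `S` together with an artifact setting over it: finitely many artifact
sorts `Art`, finitely many artifact variables (`Var s` are those of basic sort `s`), and finitely
many artifact components (`Comp e s` are those with source the artifact sort `e` and target the
basic sort `s`). -/
structure Setting (S : Signature) where
  Art : Type
  Var : S.Srt → Type
  Comp : Art → S.Srt → Type
  finite_art : Finite Art
  finite_var : ∀ s, Finite (Var s)
  finite_comp : ∀ e s, Finite (Comp e s)

namespace Setting

variable {S : Signature} (X : Setting S)

/-- Function symbols of the signature extended with artifact sorts and components. -/
def FullFunc : S.Srt ⊕ X.Art → S.Srt ⊕ X.Art → Type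
  | .inl s, .inl s' => S.Func s s'
  | .inr e, .inl s => X.Comp e s
  | _, .inr _ => Empty

/-- Constants of the extended signature; artifact variables are treated as constants. -/
def FullConst : S.Srt ⊕ X.Art → Type
  | .inl s => S.Const s ⊕ X.Var s
  | .inr _ => Empty

/-- The signature `S` extended with the artifact sorts, the artifact components (as function
symbols) and the artifact variables (as constants). Its terms and quantifier-free formulae in
context `e` are the terms `t(e, x, a)` and the quantifier-free formulae `φ(e, x, a)`. -/
def full : Signature where
  Srt := S.Srt ⊕ X.Art
  Func := X.FullFunc
  Const := X.FullConst
  finite_srt := by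
    have := S.finite_srt
    have := X.finite_art
    infer_instance
  finite_func := by
    rintro (s | e) (s' | e')
    · exact S.finite_func s s'
    · exact inferInstanceAs (Finite Empty)
    · exact X.finite_comp e s'
    · exact inferInstanceAs (Finite Empty)
  finite_const := by
    rintro (s | e)
    · have := S.finite_const s
      have := X.finite_var s
      exact inferInstanceAs (Finite (S.Const s ⊕ X.Var s))
    · exact inferInstanceAs (Finite Empty)

/-- A structure for the artifact extension: a structure for `S` and non-empty carriers for the
artifact sorts. -/
structure ExtStruc where
  base : Struc S
  art : X.Art → Type
  art_nonempty : ∀ e, Nonempty (art e)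

variable {X}

/-- An assignment to the artifact variables and the artifact components. -/
structure Asg (M : X.ExtStruc) where
  x : ∀ {s : S.Srt}, X.Var s → M.base.carrier s
  a : ∀ {e : X.Art} {s : S.Srt}, X.Comp e s → M.art e → M.base.carrier s

/-- Carriers of `Asg.toStruc`. -/
def ExtStruc.carrier (M : X.ExtStruc) : S.Srt ⊕ X.Art → Type
  | .inl s => M.base.carrier s
  | .inr e => M.art e

/-- Function symbols of `Asg.toStruc`. -/
def Asg.func {M : X.ExtStruc} (α : Asg M) :
    (s s' : S.Srt ⊕ X.Art) → X.FullFunc s s' → M.carrier s → M.carrier s'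
  | .inl _, .inl _, f => M.base.func f
  | .inr _, .inl _, f => α.a f
  | .inl _, .inr _, f => Empty.elim f
  | .inr _, .inr _, f => Empty.elim f

/-- Constants of `Asg.toStruc`. -/
def Asg.const {M : X.ExtStruc} (α : Asg M) :
    (s : S.Srt ⊕ X.Art) → X.FullConst s → M.carrier s
  | .inl _, .inl c => M.base.const c
  | .inl _, .inr v => α.x v
  | .inr _, c => Empty.elim c

/-- A structure with an assignment, seen as a structure for the full signature. -/
def Asg.toStruc {M : X.ExtStruc} (α : Asg M) : Struc X.full where
  carrier := M.carrier
  nonempty := by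
    rintro (s | e)
    · exact M.base.nonempty s
    · exact M.art_nonempty e
  func {s s'} f := α.func s s' f
  const {s} c := α.const s c

/-- A model of a theory in the signature `S`: the reduct to `S` is one. -/
def ExtStruc.Models (M : X.ExtStruc) (T : Set (Sentence S)) : Prop := M.base.Models T

variable (X)

/-- A context of variables of artifact sorts. -/
def artCtx {k : ℕ} (E : Fin k → X.Art) : Ctx X.full k := fun i => Sum.inr (E i)

/-- A formula `∃ e, φ(e, x, a)` with `φ` quantifier-free and the `e` of artifact sorts. -/
structure ExFormula where
  k : ℕ
  sorts : Fin k → X.Art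
  body : QF X.full (X.artCtx sorts)

/-- State formulae, kept as finite disjunctions of formulae `∃ e, φ(e, x, a)`. (Carriers being
non-empty, such a disjunction is again equivalent to a single formula `∃ e, φ(e, x, a)`.) The
empty list is falsity, and `++` is disjunction. -/
abbrev StateFormula : Type := List X.ExFormula

variable {X}

/-- Truth of `∃ e, φ(e, x, a)`. -/
def ExFormula.Holds (φ : X.ExFormula) {M : X.ExtStruc} (α : Asg M) : Prop :=
  ∃ ε : α.toStruc.Env (X.artCtx φ.sorts), φ.body.Holds α.toStruc ε

/-- Truth of a state formula. -/
def StateFormula.Holds (Φ : X.StateFormula) {M : X.ExtStruc} (α : Asg M) : Prop :=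
  ∃ φ ∈ Φ, ExFormula.Holds φ α

end Setting

/-- The term is a variable. -/
def Term.IsVar {S : Signature} {n : ℕ} {Γ : Ctx S n} : {s : S.Srt} → Term S Γ s → Prop
  | _, .var _ => True
  | _, .const _ => False
  | _, .app _ _ => False

/-- The variables that occur in a term. -/
def Term.vars {S : Signature} {n : ℕ} {Γ : Ctx S n} : {s : S.Srt} → Term S Γ s → Set (Fin n)
  | _, .var i => {i}
  | _, .const _ => ∅
  | _, .app _ t => t.vars

/-- The variables that occur in a quantifier-free formula. -/
def QF.vars {S : Signature} {n : ℕ} {Γ : Ctx S n} : QF S Γ → Set (Fin n)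
  | .tru => ∅
  | .eq t u => t.vars ∪ u.vars
  | .not φ => φ.vars
  | .and φ ψ => φ.vars ∪ ψ.vars
  | .or φ ψ => φ.vars ∪ ψ.vars

/-- Conjunctions `δ(e) ∧ ⋀ᵢ φᵢ(eᵢ, x, a)`: each conjunct is an equality or an inequality between
two of the variables `e`, or a quantifier-free formula in which at most one of the variables `e`
occurs. (A conjunct `ψ(x)` without any such variable is included: as carriers are non-empty, it
may be attached to any variable of artifact sort, a dummy one if need be.) -/
inductive QF.IsLocalBody {S : Signature} {n : ℕ} {Γ : Ctx S n} : QF S Γ → Prop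
  | eq {s : S.Srt} (t u : Term S Γ s) : t.IsVar → u.IsVar → IsLocalBody (QF.eq t u)
  | neq {s : S.Srt} (t u : Term S Γ s) : t.IsVar → u.IsVar → IsLocalBody (QF.not (QF.eq t u))
  | single (φ : QF S Γ) : φ.vars.Subsingleton → IsLocalBody φ
  | and (φ ψ : QF S Γ) : IsLocalBody φ → IsLocalBody ψ → IsLocalBody (QF.and φ ψ)

/-- Local state formulae: disjunctions of formulae `∃ e, (δ(e) ∧ ⋀ᵢ φᵢ(eᵢ, x, a))`. -/
def Setting.StateFormula.IsLocal {S : Signature} {X : Setting S} (Φ : X.StateFormula) : Prop :=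
  ∀ φ ∈ Φ, QF.IsLocalBody (Setting.ExFormula.body φ)

/-- A case-defined function `F(z) = case of {κ₁(z) : t₁(z); …; κₙ(z) : tₙ(z)}`, for a `T`-partition
`κ₁, …, κₙ`: modulo `T`, the conditions are exhaustive and mutually exclusive. -/
structure CaseDef {S : Signature} (X : Setting S) (T : Set (Sentence S)) {n : ℕ}
    (Γ : Ctx X.full n) (s : X.full.Srt) where
  m : ℕ
  cond : Fin m → QF X.full Γ
  term : Fin m → Term X.full Γ s
  exhaustive : ∀ (M : X.ExtStruc), M.Models T → ∀ (α : Setting.Asg M) (ε : α.toStruc.Env Γ),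
    ∃ i, (cond i).Holds α.toStruc ε
  exclusive : ∀ (M : X.ExtStruc), M.Models T → ∀ (α : Setting.Asg M) (ε : α.toStruc.Env Γ),
    ∀ i j, i ≠ j → ¬ ((cond i).Holds α.toStruc ε ∧ (cond j).Holds α.toStruc ε)

/-- `v = F(z)`: the axioms `κᵢ(z) → F(z) = tᵢ(z)`. -/
def CaseDef.IsVal {S : Signature} {X : Setting S} {T : Set (Sentence S)} {n : ℕ}
    {Γ : Ctx X.full n} {s : X.full.Srt} (F : CaseDef X T Γ s) {M : X.ExtStruc}
    (α : Setting.Asg M) (ε : α.toStruc.Env Γ) (v : α.toStruc.carrier s) : Prop :=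
  ∀ i, (F.cond i).Holds α.toStruc ε → v = (F.term i).val α.toStruc ε

/-- Transition formulae
`∃ e, (γ(e, x, a) ∧ ⋀ᵢ x'ᵢ = Fᵢ(e, x, a) ∧ ⋀ⱼ a'ⱼ = λ y. Gⱼ(y, e, x, a))`,
where the `e` may have basic as well as artifact sorts; `y` is the variable `0` of the context
of `updA`. -/
structure Transition {S : Signature} (X : Setting S) (T : Set (Sentence S)) where
  k : ℕ
  ctx : Ctx X.full k
  guard : QF X.full ctx
  updX : ∀ {s : S.Srt}, X.Var s → CaseDef X T ctx (Sum.inl s)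
  updA : ∀ {e : X.Art} {s : S.Srt}, X.Comp e s →
    CaseDef X T (Ctx.cons (S := X.full) (Sum.inr e) ctx) (Sum.inl s)

/-- Truth of a transition formula under an assignment `α` to the current and an assignment `β` to
the primed artifact variables and components. -/
def Transition.Holds {S : Signature} {X : Setting S} {T : Set (Sentence S)} (t : Transition X T)
    {M : X.ExtStruc} (α β : Setting.Asg M) : Prop :=
  ∃ ε : α.toStruc.Env t.ctx,
    t.guard.Holds α.toStruc ε ∧
    (∀ (s : S.Srt) (v : X.Var s), (t.updX v).IsVal α ε (β.x v)) ∧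
    (∀ (e : X.Art) (s : S.Srt) (c : X.Comp e s) (y : M.art e),
      (t.updA c).IsVal α (α.toStruc.consEnv (s := Sum.inr e) y ε) (β.a c y))

/-- The preimage `Pre(τ, Φ) = ∃ x' ∃ a' (τ(x, a, x', a') ∧ Φ(x', a'))` of `Φ` along the disjunction
`τ` of a finite list of transition formulae. -/
def Pre {S : Signature} {X : Setting S} {T : Set (Sentence S)} (τ : List (Transition X T))
    (Φ : X.StateFormula) {M : X.ExtStruc} (α : Setting.Asg M) : Prop :=
  ∃ β : Setting.Asg M, (∃ t ∈ τ, t.Holds α β) ∧ Φ.Holds β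

/-- A transition formula is local (with respect to `T'`) if the preimage of every local formula
is equivalent to a local formula in all models of `T'`. -/
def Transition.IsLocal {S : Signature} {X : Setting S} {T : Set (Sentence S)}
    (t : Transition X T) (T' : Set (Sentence S)) : Prop :=
  ∀ Φ : X.StateFormula, Φ.IsLocal → ∃ Ψ : X.StateFormula, Ψ.IsLocal ∧
    ∀ M : X.ExtStruc, M.Models T' → ∀ α : Setting.Asg M, Ψ.Holds α ↔ Pre [t] Φ α

/-- A relational artifact system: a DB schema (a signature with a theory of universal sentences),
an artifact setting over an artifact extension, an initial formula
`⋀ᵢ xᵢ = cᵢ ∧ ⋀ⱼ aⱼ = λ y. dⱼ` with constants `cᵢ`, `dⱼ` of the DB signature, and a finite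
disjunction of transition formulae. -/
structure RAS where
  sig : Signature
  thy : Set (Sentence sig)
  universal : ∀ φ ∈ thy, φ.IsUniversal
  setting : Setting sig
  initX : ∀ {s : sig.Srt}, setting.Var s → sig.Const s
  initA : ∀ {e : setting.Art} {s : sig.Srt}, setting.Comp e s → sig.Const s
  trans : List (Transition setting thy)

namespace RAS

variable (R : RAS)

/-- Truth of the initial formula. -/
def Init {M : R.setting.ExtStruc} (α : Setting.Asg M) : Prop :=
  (∀ (s : R.sig.Srt) (v : R.setting.Var s), α.x v = M.base.const (R.initX v)) ∧
  (∀ (e : R.setting.Art) (s : R.sig.Srt) (c : R.setting.Comp e s) (y : M.art e),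
    α.a c y = M.base.const (R.initA c))

/-- `Φ ∧ ¬ B` is satisfiable in a model of the theory of the system. -/
def SatDiff (Φ B : R.setting.StateFormula) : Prop :=
  ∃ M : R.setting.ExtStruc, M.Models R.thy ∧ ∃ α : Setting.Asg M, Φ.Holds α ∧ ¬ B.Holds α

/-- `ι ∧ Φ` is satisfiable in a model of the theory of the system. -/
def SatInit (Φ : R.setting.StateFormula) : Prop :=
  ∃ M : R.setting.ExtStruc, M.Models R.thy ∧ ∃ α : Setting.Asg M, R.Init α ∧ Φ.Holds α

/-- `Ψ` is an admissible output of quantifier elimination in `T'` on the input `Pre(τ, Φ)`: a state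
formula equivalent to `Pre(τ, Φ)` in all models of `T'`. -/
def IsQEPre (T' : Set (Sentence R.sig)) (Φ Ψ : R.setting.StateFormula) : Prop :=
  ∀ M : R.setting.ExtStruc, M.Models T' → ∀ α : Setting.Asg M, Ψ.Holds α ↔ Pre R.trans Φ α

/-- Backward search,
`while Φ ∧ ¬ B satisfiable do`
`  if ι ∧ Φ satisfiable then return unsafe; B := Φ ∨ B; Φ := Pre(τ, Φ); Φ := QE(T', Φ)`
`end; return safe`,
terminates from the values `Φ`, `B` of its variables: after finitely many rounds it returns `safe`
or `unsafe`, whatever admissible formulae the quantifier elimination produces on the way (and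
there is always such a formula). -/
inductive Terminates (T' : Set (Sentence R.sig)) :
    R.setting.StateFormula → R.setting.StateFormula → Prop
  | retSafe (Φ B : R.setting.StateFormula) : ¬ R.SatDiff Φ B → Terminates T' Φ B
  | retUnsafe (Φ B : R.setting.StateFormula) : R.SatDiff Φ B → R.SatInit Φ → Terminates T' Φ B
  | round (Φ B : R.setting.StateFormula) : R.SatDiff Φ B → ¬ R.SatInit Φ →
      (∃ Ψ, R.IsQEPre T' Φ Ψ) →
      (∀ Ψ, R.IsQEPre T' Φ Ψ → Terminates T' Ψ (Φ ++ B)) → Terminates T' Φ B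

/-- Backward search applied to the safety formula `υ` terminates; `B` starts as falsity. -/
def BackwardSearchTerminates (T' : Set (Sentence R.sig)) (υ : R.setting.StateFormula) : Prop :=
  R.Terminates T' υ []

end RAS

end ArtSys

namespace ArtSys

/-! ### Finitely many terms over an acyclic signature -/

/-! Acyclicity leaves only finitely many terms in each context, also after artifact sorts and
components are added, hence only finitely many atomic types. For an assignment with finite artifact
sorts, count how many artifact elements realize each one-variable type, and record the type of the
empty tuple; this is its profile, a point of ℕ^k for a fixed k.

A local formula compares elements only by equality and otherwise speaks of one element at a time. If
one profile is pointwise below another, there are injections of artifact sorts preserving types, so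
local formulae are monotone in the profile (`holds_of_profile_le`). A local `B` is thus governed by
an upward closed set of profiles.

If a round is entered, `Φ ∧ ¬ B` has a model of `T*` with finite artifact sorts
(`exists_finite_model`), and by monotonicity its profile is new to the set of `B`. So this set grows
strictly in every round (`profiles_lt`), which cannot go on forever: ℕ^k is a well-quasi-order by
Dickson's lemma (`wellFoundedLT_upperSet`). -/

theorem Signature.Acyclic.wellFounded {S : Signature} (h : S.Acyclic) : WellFounded S.Edge := by
  have := S.finite_srt
  have : Std.Irrefl (Relation.TransGen S.Edge) := ⟨h⟩
  exact Subrelation.wf (fun h => Relation.TransGen.single h)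
    (Finite.wellFounded_of_trans_of_irrefl (Relation.TransGen S.Edge))

/-- Well-founded induction on the sort: a compound term of sort `s` is a function symbol applied to
a term of a sort with an edge to `s`. -/
theorem Signature.Acyclic.finite_term {S : Signature} (h : S.Acyclic) {n : ℕ} (Γ : Ctx S n)
    (s : S.Srt) : Finite (Term S Γ s) := by
  induction s using h.wellFounded.induction with
  | _ s ih =>
    have := S.finite_srt
    have := S.finite_const s
    have (s' : S.Srt) : Finite (S.Func s' s × Term S Γ s') := by
      rcases isEmpty_or_nonempty (S.Func s' s) with _ | hne
      · infer_instance
      · have := S.finite_func s' s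
        have := ih s' hne
        infer_instance
    let F : {i // Γ i = s} ⊕ S.Const s ⊕ (Σ s', S.Func s' s × Term S Γ s') → Term S Γ s
      | .inl i => i.2 ▸ Term.var i.1
      | .inr (.inl c) => .const c
      | .inr (.inr p) => .app p.2.1 p.2.2
    refine Finite.of_surjective F fun t => ?_
    cases t with
    | var i => exact ⟨.inl ⟨i, rfl⟩, rfl⟩
    | const c => exact ⟨.inr (.inl c), rfl⟩
    | app f t => exact ⟨.inr (.inr ⟨_, f, t⟩), rfl⟩

/-- No symbol has an artifact sort as target, so a cycle would have to lie within the basic sorts.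
-/
theorem Setting.full_acyclic {S : Signature} (X : Setting S) (h : S.Acyclic) : X.full.Acyclic := by
  have key : ∀ a b : S.Srt ⊕ X.Art, Relation.TransGen X.full.Edge a b →
      ∃ s', b = Sum.inl s' ∧ ∀ s, a = Sum.inl s → Relation.TransGen S.Edge s s' := by
    intro a b hab
    induction hab with
    | @single b hb =>
      obtain ⟨f⟩ := hb
      rcases b with s' | e
      · refine ⟨s', rfl, ?_⟩
        rintro s rfl
        exact .single ⟨f⟩
      · rcases a with _ | _ <;> exact Empty.elim f
    | @tail b c _ hc ih =>
      obtain ⟨s₁, rfl, h₁⟩ := ih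
      obtain ⟨f⟩ := hc
      rcases c with s' | e
      · exact ⟨s', rfl, fun s hs => (h₁ s hs).tail ⟨f⟩⟩
      · exact Empty.elim f
  intro a ha
  obtain ⟨s, rfl, hs⟩ := key a a ha
  exact h s (hs s rfl)

/-! ### Atomic types -/

/-- Equations in a given context. -/
abbrev Equation (S : Signature) {n : ℕ} (Γ : Ctx S n) : Type :=
  Σ s, Term S Γ s × Term S Γ s

theorem Signature.Acyclic.finite_equation {S : Signature} (h : S.Acyclic) {n : ℕ} (Γ : Ctx S n) :
    Finite (Equation S Γ) := by
  have := S.finite_srt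
  have := h.finite_term Γ
  infer_instance

/-- The atomic type of an assignment: the equations it satisfies. -/
def Struc.atomicType {S : Signature} (M : Struc S) {n : ℕ} {Γ : Ctx S n} (ε : M.Env Γ) :
    Set (Equation S Γ) :=
  {p | p.2.1.val M ε = p.2.2.val M ε}

theorem QF.holds_iff_of_atomicType_eq {S : Signature} {M N : Struc S} {n : ℕ} {Γ : Ctx S n}
    {ε : M.Env Γ} {η : N.Env Γ} (h : M.atomicType ε = N.atomicType η) (φ : QF S Γ) :
    φ.Holds M ε ↔ φ.Holds N η := by
  induction φ with
  | tru => exact Iff.rfl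
  | @eq s t u => exact Set.ext_iff.1 h ⟨s, t, u⟩
  | not φ ih => exact not_congr ih
  | and φ ψ ih₁ ih₂ => exact and_congr ih₁ ih₂
  | or φ ψ ih₁ ih₂ => exact or_congr ih₁ ih₂

theorem Term.exists_restrict {S : Signature} {m n : ℕ} {Γ : Ctx S n} (g : Fin m → Fin n)
    {s : S.Srt} (t : Term S Γ s) (ht : t.vars ⊆ Set.range g) :
    ∃ t' : Term S (fun i => Γ (g i)) s, ∀ (M : Struc S) (ε : M.Env Γ),
      t.val M ε = t'.val M (fun i => ε (g i)) := by
  induction t with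
  | var j =>
    obtain ⟨i, rfl⟩ := ht (Set.mem_singleton j)
    exact ⟨.var i, fun _ _ => rfl⟩
  | const c => exact ⟨.const c, fun _ _ => rfl⟩
  | app f t ih =>
    obtain ⟨t', h⟩ := ih ht
    exact ⟨.app f t', fun M ε => congrArg (M.func f) (h M ε)⟩

theorem QF.exists_restrict {S : Signature} {m n : ℕ} {Γ : Ctx S n} (g : Fin m → Fin n)
    (φ : QF S Γ) (hφ : φ.vars ⊆ Set.range g) :
    ∃ φ' : QF S (fun i => Γ (g i)), ∀ (M : Struc S) (ε : M.Env Γ),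
      φ.Holds M ε ↔ φ'.Holds M (fun i => ε (g i)) := by
  induction φ with
  | tru => exact ⟨.tru, fun _ _ => Iff.rfl⟩
  | eq t u =>
    obtain ⟨t', ht⟩ := t.exists_restrict g (Set.subset_union_left.trans hφ)
    obtain ⟨u', hu⟩ := u.exists_restrict g (Set.subset_union_right.trans hφ)
    refine ⟨.eq t' u', fun M ε => ?_⟩
    simp only [QF.Holds, ht, hu]
  | not φ ih =>
    obtain ⟨φ', h⟩ := ih hφ
    exact ⟨.not φ', fun M ε => not_congr (h M ε)⟩
  | and φ ψ ih₁ ih₂ =>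
    obtain ⟨φ', h₁⟩ := ih₁ (Set.subset_union_left.trans hφ)
    obtain ⟨ψ', h₂⟩ := ih₂ (Set.subset_union_right.trans hφ)
    exact ⟨.and φ' ψ', fun M ε => and_congr (h₁ M ε) (h₂ M ε)⟩
  | or φ ψ ih₁ ih₂ =>
    obtain ⟨φ', h₁⟩ := ih₁ (Set.subset_union_left.trans hφ)
    obtain ⟨ψ', h₂⟩ := ih₂ (Set.subset_union_right.trans hφ)
    exact ⟨.or φ' ψ', fun M ε => or_congr (h₁ M ε) (h₂ M ε)⟩

theorem Term.IsVar.val_map {S : Signature} {M N : Struc S} (h : ∀ s, M.carrier s → N.carrier s)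
    {n : ℕ} {Γ : Ctx S n} (ε : M.Env Γ) {s : S.Srt} {t : Term S Γ s} (ht : t.IsVar) :
    t.val N (fun i => h _ (ε i)) = h s (t.val M ε) := by
  cases t with
  | var i => rfl
  | const c => exact ht.elim
  | app f t => exact ht.elim

theorem Term.IsVar.exists_sort_eq {S : Signature} {n : ℕ} {Γ : Ctx S n} {s : S.Srt}
    {t : Term S Γ s} (ht : t.IsVar) : ∃ i, Γ i = s := by
  cases t with
  | var i => exact ⟨i, rfl⟩
  | const c => exact ht.elim
  | app f t => exact ht.elim

/-- Bodies of local formulae are preserved by maps that are injective on the sorts of the variables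
and preserve the atomic types of single variables. -/
theorem QF.IsLocalBody.holds_map {S : Signature} {M N : Struc S}
    (h : ∀ s, M.carrier s → N.carrier s) {n : ℕ} {Γ : Ctx S n} (ε : M.Env Γ)
    (hinj : ∀ i, Function.Injective (h (Γ i)))
    (hempty : ∀ (Δ : Ctx S 0) (ζ : M.Env Δ) (η : N.Env Δ), M.atomicType ζ = N.atomicType η)
    (hsingle : ∀ i, M.atomicType (Γ := fun _ : Fin 1 => Γ i) (fun _ => ε i) =
      N.atomicType (Γ := fun _ : Fin 1 => Γ i) (fun _ => h _ (ε i)))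
    {φ : QF S Γ} (hφ : φ.IsLocalBody) (hM : φ.Holds M ε) :
    φ.Holds N (fun i => h _ (ε i)) := by
  induction hφ with
  | eq t u ht hu =>
    simp only [QF.Holds, ht.val_map h, hu.val_map h] at hM ⊢
    rw [hM]
  | neq t u ht hu =>
    -- Injectivity is available only at sorts of context variables, so the sort of the literal must
    -- be recognized as one.
    obtain ⟨i, rfl⟩ := ht.exists_sort_eq
    simp only [QF.Holds, ht.val_map h, hu.val_map h] at hM ⊢
    exact fun heq => hM (hinj i heq)
  | single φ hs =>
    rcases hs.eq_empty_or_singleton with h0 | ⟨i, h1⟩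
    · obtain ⟨φ', hφ'⟩ := φ.exists_restrict (Fin.elim0 : Fin 0 → Fin n) (by simp [h0])
      rw [hφ'] at hM ⊢
      exact (QF.holds_iff_of_atomicType_eq (hempty _ _ _) φ').1 hM
    · obtain ⟨φ', hφ'⟩ := φ.exists_restrict (fun _ : Fin 1 => i) (by simp [h1])
      rw [hφ'] at hM ⊢
      exact (QF.holds_iff_of_atomicType_eq (hsingle i) φ').1 hM
  | and φ ψ _ _ ih₁ ih₂ => exact ⟨ih₁ hM.1, ih₂ hM.2⟩

/-! ### Relations between structures that preserve and reflect quantifier-free formulae -/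

/-- A family of relations compatible with the operations and with equality. -/
structure IsPartialIso {S : Signature} (M N : Struc S)
    (r : ∀ s, M.carrier s → N.carrier s → Prop) : Prop where
  func : ∀ {s s' : S.Srt} (f : S.Func s s') a b, r s a b → r s' (M.func f a) (N.func f b)
  const : ∀ {s : S.Srt} (c : S.Const s), r s (M.const c) (N.const c)
  eq_iff : ∀ {s : S.Srt} a b a' b', r s a b → r s a' b' → (a = a' ↔ b = b')

theorem IsPartialIso.val {S : Signature} {M N : Struc S}
    {r : ∀ s, M.carrier s → N.carrier s → Prop} (hr : IsPartialIso M N r) {n : ℕ} {Γ : Ctx S n}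
    {ε : M.Env Γ} {η : N.Env Γ} (h : ∀ i, r _ (ε i) (η i)) {s : S.Srt} (t : Term S Γ s) :
    r s (t.val M ε) (t.val N η) := by
  induction t with
  | var i => exact h i
  | const c => exact hr.const c
  | app f t ih => exact hr.func f _ _ ih

theorem IsPartialIso.holds_iff {S : Signature} {M N : Struc S}
    {r : ∀ s, M.carrier s → N.carrier s → Prop} (hr : IsPartialIso M N r) {n : ℕ} {Γ : Ctx S n}
    {ε : M.Env Γ} {η : N.Env Γ} (h : ∀ i, r _ (ε i) (η i)) (φ : QF S Γ) :
    φ.Holds M ε ↔ φ.Holds N η := by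
  refine QF.holds_iff_of_atomicType_eq (Set.ext fun p => ?_) φ
  exact hr.eq_iff _ _ _ _ (hr.val h p.2.1) (hr.val h p.2.2)

/-! ### Atomic types are realized in models of the model completion -/

theorem QF.exists_conj {S : Signature} {n : ℕ} {Γ : Ctx S n} {ι : Type} (l : List ι)
    (f : ι → QF S Γ) (hf : ∀ i, (f i).IsConstraint) :
    ∃ φ : QF S Γ, φ.IsConstraint ∧ ∀ (M : Struc S) (ε : M.Env Γ),
      φ.Holds M ε ↔ ∀ i ∈ l, (f i).Holds M ε := by
  induction l with
  | nil => exact ⟨.tru, .tru, fun _ _ => by simp [QF.Holds]⟩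
  | cons i l ih =>
    obtain ⟨φ, hφ, h⟩ := ih
    exact ⟨.and (f i) φ, .and _ _ (hf i) hφ, fun M ε => by simp [QF.Holds, h]⟩

/-- As there are finitely many equations, the whole atomic type, negative part included, is one
conjunction of literals, to which the defining property of a model completion applies. -/
theorem IsModelCompletion.exists_atomicType_eq {S : Signature} (hS : S.Acyclic)
    {T T' : Set (Sentence S)} (hT : IsModelCompletion T T') {M : Struc S} (hM : M.Models T)
    {n : ℕ} {Γ : Ctx S n} (ε : M.Env Γ) :
    ∃ N : Struc S, N.Models T' ∧ ∃ η : N.Env Γ, M.atomicType ε = N.atomicType η := by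
  classical
  have := hS.finite_equation Γ
  have := Fintype.ofFinite (Equation S Γ)
  let f (p : Equation S Γ) : QF S Γ :=
    if p ∈ M.atomicType ε then .eq p.2.1 p.2.2 else .not (.eq p.2.1 p.2.2)
  have hf (p) : (f p).IsConstraint := by
    dsimp only [f]
    split_ifs
    · exact .eq _ _
    · exact .neq _ _
  have hf' (N : Struc S) (η : N.Env Γ) (p) :
      (f p).Holds N η ↔ (p ∈ M.atomicType ε ↔ p ∈ N.atomicType η) := by
    dsimp only [f]
    split_ifs with hp
    · simp only [hp, true_iff]; exact Iff.rfl
    · simp only [hp, false_iff]; exact Iff.rfl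
  obtain ⟨φ, hφ, h⟩ := QF.exists_conj (Finset.univ : Finset (Equation S Γ)).toList f hf
  obtain ⟨N, hN, η, hη⟩ := hT.sat n Γ φ hφ
    ⟨M, hM, ε, (h M ε).2 fun p _ => (hf' M ε p).2 Iff.rfl⟩
  exact ⟨N, hN, η, Set.ext fun p => (hf' N η p).1 ((h N η).1 hη p (by simp))⟩

namespace Setting

variable {S : Signature} {X : Setting S}

/-! ### Cutting down the artifact sorts -/

/-- If `Φ ∧ ¬ B` is satisfiable in a model of `T`, then it is satisfiable in a model of the model
completion with finite artifact sorts. -/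
theorem exists_finite_model (hS : S.Acyclic) {T T' : Set (Sentence S)}
    (hT : IsModelCompletion T T') {Φ B : X.StateFormula} {M : X.ExtStruc} (hM : M.Models T)
    (α : Asg M) (hΦ : Φ.Holds α) (hB : ¬ B.Holds α) :
    ∃ N : X.ExtStruc, N.Models T' ∧ (∀ e, Finite (N.art e)) ∧
      ∃ β : Asg N, Φ.Holds β ∧ ¬ B.Holds β := by
  classical
  obtain ⟨φ, hφΦ, ε, hε⟩ := hΦ
  -- Only the witnesses of `φ` are kept, plus one default element that keeps each artifact sort
  -- non-empty. The existential formula `B` stays false when artifact elements are removed.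
  let ρ : ∀ e : X.Art, {i // φ.sorts i = e} ⊕ Unit → M.art e
    | _, .inl i => i.2 ▸ (show M.art (φ.sorts i.1) from ε i.1)
    | e, .inr _ => (M.art_nonempty e).some
  let A (e : X.Art) : Type := Set.range (ρ e)
  -- The finitely many data values in use: those of the artifact variables, and of the components at
  -- the kept elements. Their joint atomic type is carried over to a model of `T'`.
  let V : Type := (Σ s, X.Var s) ⊕ (Σ e : X.Art, Σ s : S.Srt, X.Comp e s × A e)
  have : Finite V := by
    have := S.finite_srt
    have := X.finite_art
    have := X.finite_var
    have := X.finite_comp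
    have (e : X.Art) : Finite (A e) := inferInstanceAs (Finite (Set.range (ρ e)))
    infer_instance
  obtain ⟨n, ⟨v⟩⟩ := Finite.exists_equiv_fin V
  let srt : V → S.Srt := Sum.elim (fun p => p.1) (fun p => p.2.1)
  let value : ∀ p : V, M.base.carrier (srt p)
    | .inl p => α.x p.2
    | .inr p => α.a p.2.2.1 p.2.2.2.1
  let Γ : Ctx S n := fun i => srt (v.symm i)
  obtain ⟨N, hN, η, hη⟩ := hT.exists_atomicType_eq hS hM (Γ := Γ) (fun i => value (v.symm i))
  let N' : X.ExtStruc := ⟨N, A, fun e => ⟨⟨_, Set.mem_range_self (.inr ())⟩⟩⟩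
  have tm (p : V) : ∃ t : Term S Γ (srt p),
      t.val M.base (fun i => value (v.symm i)) = value p := by
    obtain ⟨i, rfl⟩ := v.symm.surjective p
    exact ⟨.var i, rfl⟩
  choose tm htm using tm
  let β : Asg N' :=
    { x := fun {s} w => (tm (.inl ⟨s, w⟩)).val N η
      a := fun {e s} c y => (tm (.inr ⟨e, s, c, y⟩)).val N η }
  -- Basic elements are related when one term names both; equality of atomic types makes this
  -- respect equality. On artifact sorts the relation is inclusion.
  let r : ∀ s : X.full.Srt, α.toStruc.carrier s → β.toStruc.carrier s → Prop
    | .inl s, a, b => ∃ t : Term S Γ s,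
        t.val M.base (fun i => value (v.symm i)) = a ∧ t.val N η = b
    | .inr e, a, b => a = b.1
  have hr : IsPartialIso α.toStruc β.toStruc r := by
    refine ⟨?_, ?_, ?_⟩
    · rintro (s | e) (s' | e') f a b h
      · obtain ⟨t, rfl, rfl⟩ := h
        exact ⟨.app f t, rfl, rfl⟩
      · exact Empty.elim f
      · have h : a = b.1 := h
        subst h
        exact ⟨tm (.inr ⟨e, s', f, b⟩), htm (.inr ⟨e, s', f, b⟩), rfl⟩
      · exact Empty.elim f
    · rintro (s | e) c
      · rcases c with c | w
        · exact ⟨.const c, rfl, rfl⟩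
        · exact ⟨tm (.inl ⟨s, w⟩), htm (.inl ⟨s, w⟩), rfl⟩
      · exact Empty.elim c
    · rintro (s | e) a b a' b' h h'
      · obtain ⟨t, rfl, rfl⟩ := h
        obtain ⟨t', rfl, rfl⟩ := h'
        exact Set.ext_iff.1 hη ⟨s, t, t'⟩
      · have h : a = b.1 := h
        have h' : a' = b'.1 := h'
        rw [h, h']
        exact Subtype.ext_iff.symm
  refine ⟨N', hN, fun e => inferInstanceAs (Finite (Set.range (ρ e))), β, ⟨φ, hφΦ, ?_⟩, ?_⟩
  · refine ⟨fun i => (⟨ρ _ (.inl ⟨i, rfl⟩), .inl ⟨i, rfl⟩, rfl⟩ : A (φ.sorts i)), ?_⟩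
    exact (hr.holds_iff (fun i => rfl) φ.body).1 hε
  · rintro ⟨ψ, hψ, ζ, hζ⟩
    refine hB ⟨ψ, hψ, fun i => (show A (ψ.sorts i) from ζ i).1, ?_⟩
    exact (hr.holds_iff (fun i => rfl) ψ.body).2 hζ

/-! ### Profiles -/

/-- The contexts with no variable and with a single variable of artifact sort. -/
def probe : Option X.Art → Σ n, Fin n → X.Art
  | none => ⟨0, Fin.elim0⟩
  | some e => ⟨1, fun _ => e⟩

/-- Atomic types in the empty context and in contexts with a single variable of artifact sort. -/
abbrev ProbeType (X : Setting S) : Type :=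
  Σ o : Option X.Art, Set (Equation X.full (X.artCtx (probe o).2))

theorem finite_probeType (hS : S.Acyclic) : Finite X.ProbeType := by
  have := X.finite_art
  have (o : Option X.Art) := (X.full_acyclic hS).finite_equation (X.artCtx (probe o).2)
  infer_instance

/-- Assignments of a given atomic type. -/
abbrev Asg.Realization {M : X.ExtStruc} (α : Asg M) (p : X.ProbeType) : Type :=
  {ε : α.toStruc.Env (X.artCtx (probe p.1).2) // α.toStruc.atomicType ε = p.2}

/-- The number of assignments of each atomic type. -/
noncomputable def Asg.profile {M : X.ExtStruc} (α : Asg M) (p : X.ProbeType) : ℕ :=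
  Nat.card (α.Realization p)

theorem Asg.finite_env {M : X.ExtStruc} (hM : ∀ e, Finite (M.art e)) (α : Asg M) {n : ℕ}
    (E : Fin n → X.Art) : Finite (α.toStruc.Env (X.artCtx E)) :=
  have (i : Fin n) : Finite (α.toStruc.carrier (X.artCtx E i)) := hM (E i)
  inferInstance

/-- Injections between the fibres over each atomic type are glued together. Finiteness matters
because `Nat.card` is 0 on infinite types. For `none` there is exactly one assignment, so the
inequality of profiles forces equal types of the empty tuple. -/
theorem Asg.exists_embedding {M N : X.ExtStruc} (hM : ∀ e, Finite (M.art e))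
    (hN : ∀ e, Finite (N.art e)) {α : Asg M} {β : Asg N} (h : α.profile ≤ β.profile)
    (o : Option X.Art) :
    ∃ f : α.toStruc.Env (X.artCtx (probe o).2) → β.toStruc.Env (X.artCtx (probe o).2),
      Function.Injective f ∧ ∀ ε, α.toStruc.atomicType ε = β.toStruc.atomicType (f ε) := by
  have hα := Asg.finite_env hM α (probe o).2
  have hβ := Asg.finite_env hN β (probe o).2
  have emb (p : Set (Equation X.full (X.artCtx (probe o).2))) :
      Nonempty (α.Realization ⟨o, p⟩ ↪ β.Realization ⟨o, p⟩) := by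
    have := Fintype.ofFinite (α.Realization ⟨o, p⟩)
    have := Fintype.ofFinite (β.Realization ⟨o, p⟩)
    refine Function.Embedding.nonempty_of_card_le ?_
    simpa only [Asg.profile, Nat.card_eq_fintype_card] using h ⟨o, p⟩
  let g p := (emb p).some
  have key (ε) : α.toStruc.atomicType ε = β.toStruc.atomicType (g (α.toStruc.atomicType ε) ⟨ε, rfl⟩).1 :=
    (g (α.toStruc.atomicType ε) ⟨ε, rfl⟩).2.symm
  refine ⟨fun ε => (g (α.toStruc.atomicType ε) ⟨ε, rfl⟩).1, fun ε ε' hεε' => ?_, key⟩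
  have hty : α.toStruc.atomicType ε' = α.toStruc.atomicType ε := by
    rw [key ε, key ε']
    exact congrArg _ hεε'.symm
  have hg : ∀ p (hp : α.toStruc.atomicType ε' = p),
      (g (α.toStruc.atomicType ε') ⟨ε', rfl⟩).1 = (g p ⟨ε', hp⟩ : β.Realization ⟨o, p⟩).1 := by
    rintro _ rfl
    rfl
  have := (g _).injective (Subtype.ext (hεε'.trans (hg _ hty)))
  exact congrArg Subtype.val this

/-- Local formulae are preserved when the profile increases. -/
theorem StateFormula.IsLocal.holds_of_profile_le {M N : X.ExtStruc} (hM : ∀ e, Finite (M.art e))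
    (hN : ∀ e, Finite (N.art e)) {α : Asg M} {β : Asg N} (h : α.profile ≤ β.profile)
    {Φ : X.StateFormula} (hΦ : Φ.IsLocal) (hα : Φ.Holds α) : Φ.Holds β := by
  obtain ⟨φ, hφ, ε, hε⟩ := hα
  obtain ⟨f₀, -, hf₀⟩ := Asg.exists_embedding hM hN h none
  have single (e : X.Art) : ∃ f : M.art e → N.art e, Function.Injective f ∧ ∀ y,
      α.toStruc.atomicType (Γ := X.artCtx fun _ : Fin 1 => e) (fun _ => y) =
        β.toStruc.atomicType (Γ := X.artCtx fun _ : Fin 1 => e) (fun _ => f y) := by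
    obtain ⟨f, hinj, hf⟩ := Asg.exists_embedding hM hN h (some e)
    have hconst (y : M.art e) : f (fun _ => y) = fun _ => f (fun _ => y) (0 : Fin 1) :=
      funext fun j : Fin 1 => by rw [Subsingleton.elim j 0]
    refine ⟨fun y => f (fun _ => y) (0 : Fin 1), fun y y' hy => ?_, fun y => ?_⟩
    · have := hinj (a₁ := fun _ => y) (a₂ := fun _ => y') (by
        rw [hconst y, hconst y']
        exact funext fun _ => hy)
      exact congrFun this (0 : Fin 1)
    · exact (hf _).trans (congrArg _ (hconst y))
  choose f hinj hf using single
  -- The values on basic sorts are arbitrary: all variables of a state formula have artifact sorts.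
  let g : ∀ s : X.full.Srt, α.toStruc.carrier s → β.toStruc.carrier s
    | .inl s, _ => (N.base.nonempty s).some
    | .inr e, y => f e y
  refine ⟨φ, hφ, fun i => g _ (ε i), (hΦ φ hφ).holds_map g ε ?_ ?_ ?_ hε⟩
  · exact fun i => hinj (φ.sorts i)
  · intro Δ ζ η
    obtain rfl : Δ = X.artCtx (probe none).2 := funext fun i => i.elim0
    exact (hf₀ ζ).trans (congrArg _ (funext fun i => i.elim0))
  · exact fun i => hf (φ.sorts i) (ε i)

/-! ### Formulae equivalent to local ones -/

/-- Equivalence to a local formula in all models of `T'`. -/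
def StateFormula.EquivLocal (T' : Set (Sentence S)) (Φ : X.StateFormula) : Prop :=
  ∃ Ψ : X.StateFormula, Ψ.IsLocal ∧
    ∀ M : X.ExtStruc, M.Models T' → ∀ α : Asg M, Φ.Holds α ↔ Ψ.Holds α

theorem StateFormula.holds_append {M : X.ExtStruc} {α : Asg M} {Φ Ψ : X.StateFormula} :
    StateFormula.Holds (Φ ++ Ψ) α ↔ Φ.Holds α ∨ Ψ.Holds α := by
  simp only [StateFormula.Holds, List.mem_append, or_and_right, exists_or]

theorem StateFormula.IsLocal.append {Φ Ψ : X.StateFormula} (hΦ : Φ.IsLocal) (hΨ : Ψ.IsLocal) :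
    StateFormula.IsLocal (Φ ++ Ψ) := fun φ hφ =>
  (List.mem_append.1 hφ).elim (hΦ φ) (hΨ φ)

theorem StateFormula.EquivLocal.append {T' : Set (Sentence S)} {Φ Ψ : X.StateFormula}
    (hΦ : Φ.EquivLocal T') (hΨ : Ψ.EquivLocal T') : StateFormula.EquivLocal T' (Φ ++ Ψ) := by
  obtain ⟨Φ', hΦ', h₁⟩ := hΦ
  obtain ⟨Ψ', hΨ', h₂⟩ := hΨ
  refine ⟨Φ' ++ Ψ', hΦ'.append hΨ', fun M hM α => ?_⟩
  rw [holds_append, holds_append, h₁ M hM, h₂ M hM]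

/-- A preimage evaluates `Φ` in the same extended structure under another assignment, so `Φ` may be
replaced by its local equivalent; preimages also commute with disjunctions of transitions. -/
theorem exists_isLocal_pre {T T' : Set (Sentence S)} (τ : List (Transition X T))
    (hτ : ∀ t ∈ τ, t.IsLocal T') {Φ : X.StateFormula} (hΦ : Φ.EquivLocal T') :
    ∃ Ψ : X.StateFormula, Ψ.IsLocal ∧
      ∀ M : X.ExtStruc, M.Models T' → ∀ α : Asg M, Ψ.Holds α ↔ Pre τ Φ α := by
  obtain ⟨Φ', hΦ', hequiv⟩ := hΦ
  induction τ with
  | nil =>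
    refine ⟨[], fun φ hφ => absurd hφ List.not_mem_nil, fun M _ α => ?_⟩
    simp [StateFormula.Holds, Pre]
  | cons t τ ih =>
    obtain ⟨Ψ₁, hΨ₁, h₁⟩ := hτ t List.mem_cons_self Φ' hΦ'
    obtain ⟨Ψ₂, hΨ₂, h₂⟩ := ih fun t' ht' => hτ t' (List.mem_cons_of_mem _ ht')
    refine ⟨Ψ₁ ++ Ψ₂, hΨ₁.append hΨ₂, fun M hM α => ?_⟩
    rw [StateFormula.holds_append, h₁ M hM, h₂ M hM]
    simp only [Pre, ← hequiv M hM, List.mem_cons, List.not_mem_nil, or_false, exists_eq_left,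
      or_and_right, exists_or]

/-- The upward closure of the profiles of the models of `T'` with finite artifact sorts in which
`B` holds. -/
def StateFormula.profiles (T' : Set (Sentence S)) (B : X.StateFormula) :
    UpperSet (X.ProbeType → ℕ) where
  carrier := {q | ∃ N : X.ExtStruc, N.Models T' ∧ (∀ e, Finite (N.art e)) ∧
    ∃ β : Asg N, B.Holds β ∧ β.profile ≤ q}
  upper' := fun _ _ hab ⟨N, hN, hfin, β, hβ, hle⟩ => ⟨N, hN, hfin, β, hβ, hle.trans hab⟩

end Setting

/-! ### Termination by Dickson's lemma -/

/-- The upper sets of a well-quasi-order satisfy the ascending chain condition for inclusion. -/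
theorem wellFoundedLT_upperSet (Q : Type*) [Preorder Q] [WellQuasiOrderedLE Q] :
    WellFoundedLT (UpperSet Q) := by
  rw [WellFoundedLT, isWellFounded_iff, RelEmbedding.wellFounded_iff_isEmpty]
  refine ⟨fun f => ?_⟩
  have hlt {i j : ℕ} (h : i < j) : f j < f i := f.map_rel_iff.2 h
  -- `UpperSet` is ordered by reverse inclusion, so the sets grow with `i`; the points new at each
  -- stage would form a bad sequence.
  have (i : ℕ) : ∃ q, q ∈ f (i + 1) ∧ q ∉ f i :=
    Set.not_subset.1 (hlt i.lt_succ_self).not_ge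
  choose q hq hq' using this
  obtain ⟨i, j, hij, hle⟩ := wellQuasiOrdered_le q
  have hmem : q i ∈ f j := by
    rcases (Nat.succ_le_of_lt hij).eq_or_lt with h | h
    · exact h ▸ hq i
    · exact (hlt h).le (hq i)
  exact hq' j ((f j).upper hle hmem)

/-- Were the profile of the finite model of `Φ ∧ ¬ B` already present, monotonicity would make `B`
true there. Since `B` is equivalent to a local formula only in models of `T'`, that model has to be
one of `T'`. -/
theorem RAS.SatDiff.profiles_lt {R : RAS} (hacyclic : R.sig.Acyclic) {T' : Set (Sentence R.sig)}
    (hT : IsModelCompletion R.thy T') {Φ B : R.setting.StateFormula} (hB : B.EquivLocal T')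
    (h : R.SatDiff Φ B) :
    Setting.StateFormula.profiles T' (Φ ++ B) < Setting.StateFormula.profiles T' B := by
  obtain ⟨M, hM, α, hΦ, hnB⟩ := h
  obtain ⟨N, hN, hfin, β, hβ, hβB⟩ := Setting.exists_finite_model hacyclic hT hM α hΦ hnB
  refine lt_of_le_not_ge ?_ fun hle => ?_
  · rintro q ⟨N, hN, hfin, β, hβ, hle⟩
    exact ⟨N, hN, hfin, β, Setting.StateFormula.holds_append.2 (.inr hβ), hle⟩
  · obtain ⟨N₁, hN₁, hfin₁, β₁, hβ₁, hle₁⟩ : β.profile ∈ Setting.StateFormula.profiles T' B :=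
      hle ⟨N, hN, hfin, β, Setting.StateFormula.holds_append.2 (.inl hβ), le_rfl⟩
    obtain ⟨B', hB', hequiv⟩ := hB
    rw [hequiv N hN] at hβB
    exact hβB (hB'.holds_of_profile_le hfin₁ hfin hle₁ ((hequiv N₁ hN₁ β₁).1 hβ₁))

theorem RAS.terminates_of_equivLocal {R : RAS} (hacyclic : R.sig.Acyclic)
    {T' : Set (Sentence R.sig)} (hT : IsModelCompletion R.thy T')
    (hlocal : ∀ t ∈ R.trans, t.IsLocal T') (Φ B : R.setting.StateFormula)
    (hΦ : Φ.EquivLocal T') (hB : B.EquivLocal T') : R.Terminates T' Φ B := by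
  have := Setting.finite_probeType (X := R.setting) hacyclic
  have := wellFoundedLT_upperSet (R.setting.ProbeType → ℕ)
  -- The invariant is equivalence to a local formula, not locality, since quantifier elimination may
  -- return any equivalent state formula.
  induction hU : Setting.StateFormula.profiles T' B using WellFoundedLT.induction
    generalizing Φ B with
  | _ U ih =>
    subst hU
    by_cases hsat : R.SatDiff Φ B
    · by_cases hinit : R.SatInit Φ
      · exact .retUnsafe Φ B hsat hinit
      · obtain ⟨Ψ₀, hΨ₀, hpre⟩ := Setting.exists_isLocal_pre R.trans hlocal hΦ
        refine .round Φ B hsat hinit ⟨Ψ₀, hpre⟩ fun Ψ hΨ => ?_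
        exact ih _ (hsat.profiles_lt hacyclic hT hB) Ψ (Φ ++ B)
          ⟨Ψ₀, hΨ₀, fun M hM α => (hΨ M hM α).trans (hpre M hM α).symm⟩ (hΦ.append hB) rfl
    · exact .retSafe Φ B hsat

end ArtSys

theorem theorem5p2 (R : ArtSys.RAS) (hacyclic : R.sig.Acyclic)
    (Tstar : Set (ArtSys.Sentence R.sig)) (hT : ArtSys.IsModelCompletion R.thy Tstar)
    (hlocal : ∀ t ∈ R.trans, t.IsLocal Tstar)
    (υ : R.setting.StateFormula) (hυ : υ.IsLocal) :
    R.BackwardSearchTerminates Tstar υ :=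
  ArtSys.RAS.terminates_of_equivLocal hacyclic hT hlocal υ []
    ⟨υ, hυ, fun _ _ _ => Iff.rfl⟩
    ⟨[], fun _ hφ => absurd hφ List.not_mem_nil, fun _ _ _ => Iff.rfl⟩
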